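/- Let $n\ge 0$ be an integer, let $\omega\in\mathbb{R}^n$, and let $M\subset\mathbb{R}^{2n}$ be an open set containing the origin, with coordinates $z=(q,p)=(q_1,\dots,q_n,p_1,\dots,p_n)$ and the Poisson bracket $\{F,G\}=\sum_{j=1}^n\left(\frac{\partial F}{\partial q_j}\frac{\partial G}{\partial p_j}-\frac{\partial F}{\partial p_j}\frac{\partial G}{\partial q_j}\right)$. Put $I_j(q,p)=\frac{p_j^2+q_j^2}{2}$ and $H_0=\sum_{j=1}^n\omega_j I_j$. Let $H=H_0+P$ with $P\in C^\infty(M,\mathbb{R})$ and $P(z)=O(\|z\|^3)$ as $z\to 0$, and let $r\ge 3$ be an integer. Then there are open neighborhoods $\mathcal U,\mathcal V\subset M$ of the origin, a real analytic canonical transformation $\tau:\mathcal U\to\mathcal V$ (a bijection that is real analytic together with its inverse and satisfies $\{F,G\}\circ\tau=\{F\circ\tau,G\circ\tau\}$ on $\mathcal U$ for all $F,G\in C^\infty(\mathcal V,\mathbb{R})$), a real polynomial $Z$ in $(q,p)$ and a function $R\in C^\infty(M,\mathbb{R})$ such that $$H\circ\tau=H_0+Z+R\quad\text{on }\mathcal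 U,$$ and (i) $Z$ has degree at most $r$ and is in normal form: $\{Z,H_0\}=0$; (ii) $R(z)=O(\|z\|^{r+1})$ as $z\to 0$; (iii) $\tau(z)=z+O(\|z\|^2)$ as $z\to 0$; (iv) if $\omega$ is non-resonant up to order $r$, that is, $\sum_{j=1}^n k_j\omega_j\ne 0$ for all $k\in\mathbb{Z}^n$ with $0<|k_1|+\dots+|k_n|\le r$, then $Z$ depends only on the actions: $Z=W(I_1,\dots,I_n)$ for a real polynomial $W$ in $n$ variables. -/

import Mathlib

open scoped Topology Asymptotics

noncomputable section

namespace Birkhoff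

/-- The phase space `ℝ^{2n}`: for `z = (q, p)` we have `q_j = z (Sum.inl j)` and
`p_j = z (Sum.inr j)`. -/
abbrev Phase (n : ℕ) : Type := EuclideanSpace ℝ (Fin n ⊕ Fin n)

/-- The partial derivative of `F` in the coordinate `i`, at the point `z`. -/
def partialDeriv {n : ℕ} (i : Fin n ⊕ Fin n) (F : Phase n → ℝ) (z : Phase n) : ℝ :=
  fderiv ℝ F z (EuclideanSpace.single i 1)

/-- The Poisson bracket
`{F, G} = ∑ j, (∂F/∂q_j * ∂G/∂p_j - ∂F/∂p_j * ∂G/∂q_j)`. -/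
def poissonBracket {n : ℕ} (F G : Phase n → ℝ) (z : Phase n) : ℝ :=
  ∑ j : Fin n,
    (partialDeriv (Sum.inl j) F z * partialDeriv (Sum.inr j) G z -
      partialDeriv (Sum.inr j) F z * partialDeriv (Sum.inl j) G z)

/-- The action `I_j(q, p) = (p_j² + q_j²) / 2`. -/
def action {n : ℕ} (j : Fin n) (z : Phase n) : ℝ :=
  (z (Sum.inr j) ^ 2 + z (Sum.inl j) ^ 2) / 2

/-- The harmonic oscillator `H₀ = ∑ j, ω_j I_j`. -/
def harmonicOscillator {n : ℕ} (ω : Fin n → ℝ) (z : Phase n) : ℝ :=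
  ∑ j : Fin n, ω j * action j z

/-- `ω` is non-resonant up to order `r`: `k · ω ≠ 0` for every integer vector `k` with
`0 < |k₁| + ⋯ + |kₙ| ≤ r`. -/
def NonResonantUpTo {n : ℕ} (ω : Fin n → ℝ) (r : ℕ) : Prop :=
  ∀ k : Fin n → ℤ, 0 < ∑ j, |k j| → ∑ j, |k j| ≤ (r : ℤ) → ∑ j, (k j : ℝ) * ω j ≠ 0

/-- The function on phase space given by a real polynomial in the `2n` coordinates. -/
def polyFun {n : ℕ} (Z : MvPolynomial (Fin n ⊕ Fin n) ℝ) (z : Phase n) : ℝ :=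
  MvPolynomial.eval (fun i => z i) Z

/-- A bijection `τ` from the open set `τ.source` onto the open set `τ.target` is a real analytic
canonical transformation if `τ` and its inverse are real analytic and `τ` preserves the Poisson
bracket of smooth functions. -/
structure IsAnalyticCanonical {n : ℕ} (τ : OpenPartialHomeomorph (Phase n) (Phase n)) :
    Prop where
  analytic : AnalyticOnNhd ℝ τ τ.source
  analytic_symm : AnalyticOnNhd ℝ τ.symm τ.target
  bracket : ∀ F G : Phase n → ℝ,
    ContDiffOn ℝ ((⊤ : ℕ∞) : WithTop ℕ∞) F τ.target →
    ContDiffOn ℝ ((⊤ : ℕ∞) : WithTop ℕ∞) G τ.target →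
    ∀ z ∈ τ.source, poissonBracket F G (τ z) = poissonBracket (F ∘ τ) (G ∘ τ) z

end Birkhoff

end

open scoped Topology Asymptotics

noncomputable section

namespace Birkhoff

/-! The part of the Hamiltonian that does not commute with `H₀` is removed degree by degree. Put `L
= {H₀, ·}`. In the coordinates `ξ_j = q_j + i p_j`, `η_j = q_j - i p_j` every monomial is an
eigenvector of `L`, with eigenvalue `i k·ω`, where `k_j` is the exponent of `ξ_j` minus that of
`η_j`. Hence a homogeneous `f` splits as `L χ + Z` with `L Z = 0` (`exists_homological_solution`),
and non-resonance leaves in `Z` only products of the `ξ_j η_j = 2 I_j`.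

To remove `L χ`, a canonical map is needed that moves `H₀` by `-L χ` up to higher order. Instead of
the time-one flow of `χ`, which is not explicit, `χ` is written as a combination of powers of linear
forms (`mem_span_pow_linearForm`). A linear form `ℓ` is conserved by the flow of `ℓ ^ s`, so that
flow is an explicit polynomial shear with polynomial inverse, and a composite of shears has the
required leading effect (`exists_isPolyCanonical_of_generator`). Iterating gives
`exists_polynomial_normalForm`, with a globally defined polynomial transformation.

Orders of vanishing are tracked through powers of the ideal `𝔪` of the variables; `polyFun_isBigO`
and `mem_pow_idealOfVars_of_isBigO` translate them to and from `O(‖z‖ ^ k)`. A smooth `P` is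
replaced by a Taylor polynomial, whose error is absorbed in `R`. -/

open MvPolynomial

/-! ### Filtration by powers of the ideal of variables, and powers of linear forms. -/

section Algebra

variable {σ : Type*}

/-- A polynomial homogeneous of degree `k` lies in the `k`-th power of the ideal of variables. -/
theorem mem_pow_idealOfVars_of_isHomogeneous {R : Type*} [CommSemiring R] {p : MvPolynomial σ R}
    {k : ℕ} (hp : p.IsHomogeneous k) : p ∈ idealOfVars σ R ^ k := by
  rw [mem_pow_idealOfVars_iff']
  intro x hx
  exact hp.coeff_eq_zero hx.ne

theorem sub_homogeneousComponent_mem {R : Type*} [CommRing R] {p : MvPolynomial σ R} {k : ℕ}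
    (hp : p ∈ idealOfVars σ R ^ k) :
    p - homogeneousComponent k p ∈ idealOfVars σ R ^ (k + 1) := by
  rw [mem_pow_idealOfVars_iff'] at hp ⊢
  intro x hx
  rw [coeff_sub, coeff_homogeneousComponent]
  split_ifs with h
  · simp
  · simp [hp x (by omega)]

/-- An endomorphism which moves each variable by an element of `𝔪 ^ k` moves each element of
`𝔪 ^ m` by an element of `𝔪 ^ (m + k - 1)`. -/
theorem algHom_sub_self_mem {R : Type*} [CommRing R]
    {T : MvPolynomial σ R →ₐ[R] MvPolynomial σ R} {k : ℕ}
    (hT : ∀ i, T (X i) - X i ∈ idealOfVars σ R ^ (k + 1)) {m : ℕ} {p : MvPolynomial σ R}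
    (hp : p ∈ idealOfVars σ R ^ m) : T p - p ∈ idealOfVars σ R ^ (m + k) := by
  have hX : ∀ i, (X i : MvPolynomial σ R) ∈ idealOfVars σ R := fun i =>
    Ideal.subset_span ⟨i, rfl⟩
  -- The cases `m = 0` and `m = 1` come first; higher `m` follow from `T(ab) - ab = (Ta - a) Tb + a
  -- (Tb - b)`.
  have h0 : ∀ p : MvPolynomial σ R, T p - p ∈ idealOfVars σ R ^ k := by
    intro p
    induction p using MvPolynomial.induction_on with
    | C a => simp [← algebraMap_eq]
    | add p q hp hq =>
      rw [map_add, add_sub_add_comm]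
      exact add_mem hp hq
    | mul_X p i hp =>
      have : T (p * X i) - p * X i = T (X i) * (T p - p) + p * (T (X i) - X i) := by
        rw [map_mul]; ring
      rw [this]
      exact add_mem (Ideal.mul_mem_left _ _ hp)
        (Ideal.mul_mem_left _ _ (Ideal.pow_le_pow_right (Nat.le_succ k) (hT i)))
  have h1 : ∀ q ∈ idealOfVars σ R, T q - q ∈ idealOfVars σ R ^ (k + 1) := by
    intro q hq
    induction hq using Submodule.span_induction with
    | mem x hx => obtain ⟨i, rfl⟩ := hx; exact hT i
    | zero => simp
    | add p q _ _ hp hq =>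
      rw [map_add, add_sub_add_comm]
      exact add_mem hp hq
    | smul a q hq ih =>
      have : T (a • q) - a • q = T a * (T q - q) + (T a - a) * q := by
        rw [smul_eq_mul, map_mul]; ring
      rw [this]
      refine add_mem (Ideal.mul_mem_left _ _ ih) ?_
      rw [pow_succ]
      exact Ideal.mul_mem_mul (h0 a) hq
  have hmap : ∀ q ∈ idealOfVars σ R, T q ∈ idealOfVars σ R := by
    intro q hq
    have := add_mem (Ideal.pow_le_self (Nat.succ_ne_zero k) (h1 q hq)) hq
    simpa using this
  induction m generalizing p with
  | zero => simpa using h0 p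
  | succ m ih =>
    rw [pow_succ] at hp
    induction hp using Submodule.mul_induction_on' with
    | mem_mul_mem a ha b hb =>
      have : T (a * b) - a * b = (T a - a) * T b + a * (T b - b) := by
        rw [map_mul]; ring
      rw [this]
      refine add_mem ?_ ?_
      · rw [show m + 1 + k = m + k + 1 by ring, pow_succ]
        exact Ideal.mul_mem_mul (ih ha) (hmap b hb)
      · rw [show m + 1 + k = m + (k + 1) by ring, pow_add]
        exact Ideal.mul_mem_mul ha (h1 b hb)
    | add p _ q _ hp hq =>
      rw [map_add, add_sub_add_comm]
      exact add_mem hp hq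

/-- Homogeneous polynomials over a field of characteristic zero are linear combinations of powers
of linear forms. -/
theorem mem_span_pow_linearForm {K : Type*} [Field K] [CharZero K] [Fintype σ]
    {f : MvPolynomial σ K} {s : ℕ} (hf : f.IsHomogeneous s) :
    f ∈ Submodule.span K (Set.range fun a : σ → K => (∑ i, a i • (X i : MvPolynomial σ K)) ^ s) := by
  classical
  -- Duality: a functional `φ` that kills all `s`-th powers of linear forms is shown to kill every
  -- monomial of degree `s`.
  by_contra hcon
  obtain ⟨φ, hφf, hφ⟩ := Submodule.exists_le_ker_of_notMem hcon
  have hpow : ∀ a : σ → K, (∑ i, a i • (X i : MvPolynomial σ K)) ^ s =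
      ∑ m ∈ Finset.univ.finsuppAntidiag s,
        (m.multinomial * m.prod (fun r e => a r ^ e) : K) • monomial m (1 : K) := by
    intro a
    ext d
    rw [coeff_linearCombination_X_pow_of_fintype, coeff_sum]
    simp only [coeff_smul, coeff_monomial, smul_eq_mul, mul_ite, mul_one, mul_zero,
      Finset.sum_ite_eq', Finset.mem_finsuppAntidiag, Finset.subset_univ, and_true]
    rw [Finsupp.sum_fintype _ _ (fun _ => rfl)]
  -- As a function of `a`, `φ` of the `s`-th power is a polynomial that vanishes everywhere, hence
  -- is zero. Its coefficients are multinomial numbers, nonzero in characteristic zero, times the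
  -- values of `φ` on monomials.
  have hg : (∑ m ∈ Finset.univ.finsuppAntidiag s,
      monomial m (m.multinomial * φ (monomial m (1 : K)) : K) : MvPolynomial σ K) = 0 := by
    apply MvPolynomial.funext
    intro a
    have h1 : φ ((∑ i, a i • (X i : MvPolynomial σ K)) ^ s) = 0 :=
      hφ (Submodule.subset_span ⟨a, rfl⟩)
    rw [hpow, map_sum] at h1
    rw [map_zero, ← h1, map_sum]
    refine Finset.sum_congr rfl fun m _ => ?_
    rw [eval_monomial, map_smul, smul_eq_mul]
    ring
  have hmon : ∀ m : σ →₀ ℕ, m.degree = s → φ (monomial m (1 : K)) = 0 := by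
    intro m hm
    have h1 := congrArg (coeff m) hg
    rw [coeff_sum] at h1
    simp only [coeff_monomial, Finset.sum_ite_eq', Finset.mem_finsuppAntidiag,
      Finset.subset_univ, and_true, coeff_zero] at h1
    rw [if_pos (by rw [← hm, Finsupp.degree_eq_sum])] at h1
    have h2 : (m.multinomial : K) ≠ 0 := by
      exact_mod_cast (Nat.multinomial_pos _ _).ne'
    exact (mul_eq_zero.mp h1).resolve_left h2
  apply hφf
  rw [f.as_sum, map_sum]
  refine Finset.sum_eq_zero fun m hm => ?_
  have : monomial m (coeff m f) = coeff m f • monomial m (1 : K) := by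
    rw [smul_monomial, smul_eq_mul, mul_one]
  rw [this, map_smul, hmon m ?_, smul_zero]
  by_contra hne
  exact (mem_support_iff.mp hm) (hf.coeff_eq_zero hne)

end Algebra

/-! ### Coefficientwise real parts of complex polynomials. -/

section RePart

variable {σ : Type*}

/-- The polynomial whose coefficients are the images of those of `p` under an additive map. -/
def mapCoeff (φ : ℂ →+ ℝ) (p : MvPolynomial σ ℂ) : MvPolynomial σ ℝ :=
  ∑ m ∈ p.support, monomial m (φ (coeff m p))

theorem coeff_mapCoeff (φ : ℂ →+ ℝ) (p : MvPolynomial σ ℂ) (m : σ →₀ ℕ) :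
    coeff m (mapCoeff φ p) = φ (coeff m p) := by
  classical
  rw [mapCoeff, coeff_sum]
  simp only [coeff_monomial, Finset.sum_ite_eq', mem_support_iff, ite_not]
  split_ifs with h
  · rw [h, map_zero]
  · rfl

theorem mapCoeff_add (φ : ℂ →+ ℝ) (p q : MvPolynomial σ ℂ) :
    mapCoeff φ (p + q) = mapCoeff φ p + mapCoeff φ q := by
  ext m; simp [coeff_mapCoeff]

theorem isHomogeneous_mapCoeff (φ : ℂ →+ ℝ) {p : MvPolynomial σ ℂ} {s : ℕ}
    (hp : p.IsHomogeneous s) : (mapCoeff φ p).IsHomogeneous s := by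
  intro m hm
  apply hp
  intro h
  rw [coeff_mapCoeff, h, map_zero] at hm
  exact hm rfl

/-- The coefficientwise real part of a complex polynomial. -/
def rePart : MvPolynomial σ ℂ →+ MvPolynomial σ ℝ where
  toFun := mapCoeff Complex.reAddGroupHom
  map_zero' := by ext m; simp [coeff_mapCoeff]
  map_add' := mapCoeff_add _

theorem coeff_rePart (p : MvPolynomial σ ℂ) (m : σ →₀ ℕ) :
    coeff m (rePart p) = (coeff m p).re :=
  coeff_mapCoeff _ p m

theorem isHomogeneous_rePart {p : MvPolynomial σ ℂ} {s : ℕ} (hp : p.IsHomogeneous s) :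
    (rePart p).IsHomogeneous s :=
  isHomogeneous_mapCoeff _ hp

theorem rePart_C_mul_map (c : ℂ) (p : MvPolynomial σ ℝ) :
    rePart (C c * map Complex.ofRealHom p) = C c.re * p := by
  ext m; simp [coeff_rePart, coeff_map]

theorem rePart_map (p : MvPolynomial σ ℝ) : rePart (map Complex.ofRealHom p) = p := by
  ext m; simp [coeff_rePart, coeff_map]

theorem exists_eq_map_rePart_add (p : MvPolynomial σ ℂ) :
    ∃ q : MvPolynomial σ ℝ,
      p = map Complex.ofRealHom (rePart p) + C Complex.I * map Complex.ofRealHom q := by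
  refine ⟨mapCoeff Complex.imAddGroupHom p, ?_⟩
  ext m
  rw [coeff_add, coeff_C_mul, coeff_map, coeff_map, coeff_rePart, coeff_mapCoeff, mul_comm]
  exact (Complex.re_add_im _).symm

end RePart

/-! ### The homological equation. -/

section Homological

variable {n : ℕ}

/-- The derivation `{H₀, ·}` of the polynomial ring. -/
def oscDerivation {R : Type*} [CommRing R] (ω : Fin n → R) :
    Derivation R (MvPolynomial (Fin n ⊕ Fin n) R) (MvPolynomial (Fin n ⊕ Fin n) R) :=
  mkDerivation R (Sum.elim (fun j => -(C (ω j) * X (Sum.inr j))) (fun j => C (ω j) * X (Sum.inl j)))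

theorem oscDerivation_inl {R : Type*} [CommRing R] (ω : Fin n → R) (j : Fin n) :
    oscDerivation ω (X (Sum.inl j)) = -(C (ω j) * X (Sum.inr j)) := by
  simp [oscDerivation, mkDerivation_X]

theorem oscDerivation_inr {R : Type*} [CommRing R] (ω : Fin n → R) (j : Fin n) :
    oscDerivation ω (X (Sum.inr j)) = C (ω j) * X (Sum.inl j) := by
  simp [oscDerivation, mkDerivation_X]

theorem derivation_C_mul_eq {σ R : Type*} [CommRing R]
    (D : Derivation R (MvPolynomial σ R) (MvPolynomial σ R)) (a : R) (f : MvPolynomial σ R) :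
    D (C a * f) = C a * D f := by
  rw [Derivation.leibniz, derivation_C, smul_zero, add_zero, smul_eq_mul]

theorem map_oscDerivation (ω : Fin n → ℝ) (p : MvPolynomial (Fin n ⊕ Fin n) ℝ) :
    map Complex.ofRealHom (oscDerivation ω p) =
      oscDerivation (fun j => (ω j : ℂ)) (map Complex.ofRealHom p) := by
  induction p using MvPolynomial.induction_on with
  | C a => simp [derivation_C]
  | add p q hp hq => simp [hp, hq]
  | mul_X p i hp =>
    rw [Derivation.leibniz, map_add, smul_eq_mul, smul_eq_mul, map_mul, map_mul, hp, map_mul,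
      Derivation.leibniz, smul_eq_mul, smul_eq_mul, map_X]
    rcases i with j | j
    · simp [oscDerivation_inl]
    · simp [oscDerivation_inr]

/-- `L` has real coefficients, so it respects real and imaginary parts. This lets the homological
equation be solved over `ℂ` and the solution be brought back to `ℝ`. -/
theorem rePart_oscDerivation (ω : Fin n → ℝ) (p : MvPolynomial (Fin n ⊕ Fin n) ℂ) :
    rePart (oscDerivation (fun j => (ω j : ℂ)) p) = oscDerivation ω (rePart p) := by
  obtain ⟨q, hq⟩ := exists_eq_map_rePart_add p
  conv_lhs => rw [hq]
  rw [map_add, derivation_C_mul_eq, ← map_oscDerivation, ← map_oscDerivation, map_add, rePart_map,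
    rePart_C_mul_map]
  simp

theorem isHomogeneous_oscDerivation {R : Type*} [CommRing R] (ω : Fin n → R)
    {p : MvPolynomial (Fin n ⊕ Fin n) R} {s : ℕ} (hp : p.IsHomogeneous s) :
    (oscDerivation ω p).IsHomogeneous s := by
  rw [p.as_sum, map_sum]
  refine IsHomogeneous.sum _ _ _ fun m hm => ?_
  have hdeg : m.degree = s := by
    by_contra hne
    exact (mem_support_iff.mp hm) (hp.coeff_eq_zero hne)
  rw [oscDerivation, mkDerivation_monomial]
  rw [smul_eq_C_mul]
  refine IsHomogeneous.C_mul (IsHomogeneous.sum _ _ _ fun i hi => ?_) _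
  have h1 : (monomial (m - Finsupp.single i 1) (m i : R)).IsHomogeneous (s - 1) := by
    apply isHomogeneous_monomial
    have hle : Finsupp.single i 1 ≤ m := by
      simpa [Nat.one_le_iff_ne_zero] using hi
    have h := congrArg Finsupp.degree (tsub_add_cancel_of_le hle)
    rw [map_add, Finsupp.degree_single, hdeg] at h
    omega
  -- A variable occurring in `m` forces positive degree, so the truncated `s - 1` is a genuine
  -- difference.
  have h2 : 1 ≤ s := by
    rw [← hdeg]
    exact (Nat.one_le_iff_ne_zero.mpr (Finsupp.mem_support_iff.mp hi)).trans
      (Finsupp.le_degree i m)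
  have h3 : (Sum.elim (fun j => -(C (ω j) * X (Sum.inr j))) (fun j => C (ω j) * X (Sum.inl j)) i :
      MvPolynomial (Fin n ⊕ Fin n) R).IsHomogeneous 1 := by
    rcases i with j | j
    · exact (isHomogeneous_C_mul_X _ _).neg
    · exact isHomogeneous_C_mul_X _ _
  have := h1.mul h3
  rwa [Nat.sub_add_cancel h2] at this

/-- The complex coordinates `ξ_j = q_j + i p_j` and `η_j = q_j - i p_j`. -/
def complexCoord (i : Fin n ⊕ Fin n) : MvPolynomial (Fin n ⊕ Fin n) ℂ :=
  Sum.elim (fun j => X (Sum.inl j) + C Complex.I * X (Sum.inr j))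
    (fun j => X (Sum.inl j) - C Complex.I * X (Sum.inr j)) i

/-- The frequencies of the complex coordinates under the flow of `H₀`. -/
def coordFreq (ω : Fin n → ℝ) (i : Fin n ⊕ Fin n) : ℝ := Sum.elim ω (fun j => -ω j) i

theorem C_I_mul_C_I {σ : Type*} :
    (C Complex.I * C Complex.I : MvPolynomial σ ℂ) = -1 := by
  rw [← C_mul, Complex.I_mul_I, C_neg, C_1]

theorem oscDerivation_complexCoord (ω : Fin n → ℝ) (i : Fin n ⊕ Fin n) :
    oscDerivation (fun j => (ω j : ℂ)) (complexCoord i) =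
      C (Complex.I * (coordFreq ω i : ℝ)) * complexCoord i := by
  rcases i with j | j
  · simp only [complexCoord, coordFreq, Sum.elim_inl, map_add, derivation_C_mul_eq,
      oscDerivation_inl, oscDerivation_inr, C_mul]
    linear_combination (-C (ω j : ℂ) * X (Sum.inr j)) * C_I_mul_C_I (σ := Fin n ⊕ Fin n)
  · simp only [complexCoord, coordFreq, Sum.elim_inr, map_sub, derivation_C_mul_eq,
      oscDerivation_inl, oscDerivation_inr, C_mul, Complex.ofReal_neg, C_neg]
    linear_combination (-C (ω j : ℂ) * X (Sum.inr j)) * C_I_mul_C_I (σ := Fin n ⊕ Fin n)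

theorem isHomogeneous_complexCoord (i : Fin n ⊕ Fin n) : (complexCoord i).IsHomogeneous 1 := by
  rcases i with j | j
  · exact (isHomogeneous_X _ _).add (isHomogeneous_C_mul_X _ _)
  · exact (isHomogeneous_X _ _).sub (isHomogeneous_C_mul_X _ _)

/-- A monomial in the complex coordinates. -/
def complexMonomial (m : Fin n ⊕ Fin n →₀ ℕ) : MvPolynomial (Fin n ⊕ Fin n) ℂ :=
  ∏ i, complexCoord i ^ m i

theorem isHomogeneous_complexMonomial (m : Fin n ⊕ Fin n →₀ ℕ) :
    (complexMonomial m).IsHomogeneous m.degree := by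
  rw [Finsupp.degree_eq_sum]
  refine IsHomogeneous.prod _ _ _ fun i _ => ?_
  simpa using (isHomogeneous_complexCoord i).pow (m i)

/-- Under a derivation eigenvectors multiply and eigenvalues add. -/
theorem derivation_prod_pow_of_eigen {R A ι : Type*} [CommRing R] [CommRing A] [Algebra R A]
    (D : Derivation R A A) (u : ι → A) (c : ι → A) (hu : ∀ i, D (u i) = c i * u i)
    (s : Finset ι) (m : ι → ℕ) :
    D (∏ i ∈ s, u i ^ m i) = (∑ i ∈ s, (m i : A) * c i) * ∏ i ∈ s, u i ^ m i := by
  classical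
  have hpow : ∀ (i : ι) (k : ℕ), D (u i ^ k) = (k : A) * c i * u i ^ k := by
    intro i k
    induction k with
    | zero => simp
    | succ k ih =>
      rw [pow_succ, Derivation.leibniz, ih, hu, smul_eq_mul, smul_eq_mul]
      push_cast; ring
  induction s using Finset.induction_on with
  | empty => simp
  | insert a s ha ih =>
    rw [Finset.prod_insert ha, Finset.sum_insert ha, Derivation.leibniz, ih, hpow, smul_eq_mul,
      smul_eq_mul]
    ring

theorem oscDerivation_complexMonomial (ω : Fin n → ℝ) (m : Fin n ⊕ Fin n →₀ ℕ) :
    oscDerivation (fun j => (ω j : ℂ)) (complexMonomial m) =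
      C (Complex.I * ((∑ i, m i * coordFreq ω i : ℝ) : ℂ)) * complexMonomial m := by
  rw [complexMonomial, derivation_prod_pow_of_eigen _ _ _ (oscDerivation_complexCoord ω)]
  congr 1
  push_cast
  rw [Finset.mul_sum, map_sum]
  refine Finset.sum_congr rfl fun i _ => ?_
  simp only [C_mul, map_natCast]
  ring

theorem aeval_complexCoord_monomial (m : Fin n ⊕ Fin n →₀ ℕ) (c : ℂ) :
    aeval complexCoord (monomial m c) = C c * complexMonomial m := by
  rw [aeval_monomial, algebraMap_eq, complexMonomial, Finsupp.prod_fintype _ _ (fun _ => pow_zero _)]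

/-- Every real polynomial is a polynomial in the complex coordinates. -/
theorem exists_aeval_complexCoord_eq {s : ℕ} {f : MvPolynomial (Fin n ⊕ Fin n) ℝ}
    (hf : f.IsHomogeneous s) : ∃ g : MvPolynomial (Fin n ⊕ Fin n) ℂ, g.IsHomogeneous s ∧
      aeval complexCoord g = map Complex.ofRealHom f := by
  -- The inverse change of coordinates `q = (ξ + η) / 2`, `p = -i (ξ - η) / 2`, the variables now
  -- standing for `ξ` and `η`.
  set v : Fin n ⊕ Fin n → MvPolynomial (Fin n ⊕ Fin n) ℂ :=
    Sum.elim (fun j => C (1 / 2) * X (Sum.inl j) + C (1 / 2) * X (Sum.inr j))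
      (fun j => C (-Complex.I / 2) * X (Sum.inl j) - C (-Complex.I / 2) * X (Sum.inr j)) with hv
  have hvX : ∀ i, aeval complexCoord (v i) = X i := by
    have h2 : (C (1 / 2 : ℂ) + C (1 / 2) : MvPolynomial (Fin n ⊕ Fin n) ℂ) = 1 := by
      rw [← C_add, add_halves, C_1]
    have hI : (C (-Complex.I / 2) : MvPolynomial (Fin n ⊕ Fin n) ℂ) =
        -C Complex.I * C (1 / 2 : ℂ) := by
      rw [← C_neg, ← C_mul]; congr 1; ring
    rintro (j | j)
    · simp only [hv, Sum.elim_inl, map_add, map_mul, aeval_X, complexCoord, Sum.elim_inr,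
        ← algebraMap_eq, AlgHom.commutes]
      simp only [algebraMap_eq]
      linear_combination X (Sum.inl j) * h2
    · simp only [hv, Sum.elim_inl, map_sub, map_mul, aeval_X, complexCoord, Sum.elim_inr,
        ← algebraMap_eq, AlgHom.commutes]
      simp only [algebraMap_eq]
      rw [hI]
      linear_combination X (Sum.inr j) * h2 - 2 * X (Sum.inr j) * C (1 / 2 : ℂ) *
        C_I_mul_C_I (σ := Fin n ⊕ Fin n)
  refine ⟨eval₂ (C.comp Complex.ofRealHom) v f, ?_, ?_⟩
  · have := hf.eval₂ (C.comp Complex.ofRealHom) v (n := 1) (fun r => isHomogeneous_C _ _) ?_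
    · simpa using this
    · rintro (j | j)
      · exact (isHomogeneous_C_mul_X _ _).add (isHomogeneous_C_mul_X _ _)
      · exact (isHomogeneous_C_mul_X _ _).sub (isHomogeneous_C_mul_X _ _)
  · clear hf
    induction f using MvPolynomial.induction_on with
    | C a => simp [algebraMap_eq]
    | add p q hp hq => simp only [eval₂_add, map_add, hp, hq]
    | mul_X p i hp => simp only [eval₂_mul, map_mul, hp, eval₂_X, hvX, map_X]

/-- The action `I_j` as a polynomial. -/
def actionPoly (j : Fin n) : MvPolynomial (Fin n ⊕ Fin n) ℝ :=
  C (1 / 2) * (X (Sum.inr j) ^ 2 + X (Sum.inl j) ^ 2)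

/-- Equal exponents pair the factors into `ξ_j η_j = q_j² + p_j² = 2 I_j`. -/
theorem complexMonomial_eq_of_diag {m : Fin n ⊕ Fin n →₀ ℕ}
    (hm : ∀ j, m (Sum.inl j) = m (Sum.inr j)) :
    complexMonomial m = map Complex.ofRealHom
      (aeval actionPoly (∏ j : Fin n, (C 2 * X j) ^ m (Sum.inl j) : MvPolynomial (Fin n) ℝ)) := by
  rw [complexMonomial, Fintype.prod_sum_type, ← Finset.prod_mul_distrib, map_prod, map_prod]
  refine Finset.prod_congr rfl fun j _ => ?_
  rw [← hm, ← mul_pow, map_pow, map_pow]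
  congr 1
  have h2 : (C (2 : ℂ) * C (1 / 2) : MvPolynomial (Fin n ⊕ Fin n) ℂ) = 1 := by
    rw [← C_mul]; norm_num
  simp only [complexCoord, Sum.elim_inl, Sum.elim_inr, map_mul, aeval_X, actionPoly, map_add,
    map_pow, map_X, map_C, aeval_C, algebraMap_eq]
  simp only [Complex.ofRealHom_eq_coe, Complex.ofReal_div, Complex.ofReal_one, Complex.ofReal_ofNat]
  linear_combination (-X (Sum.inr j) ^ 2) * C_I_mul_C_I (σ := Fin n ⊕ Fin n) -
    (X (Sum.inr j) ^ 2 + X (Sum.inl j) ^ 2) * h2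

/-- The eigenvalue is `k·ω` up to the factor `i`, with `k` the difference of the exponents, and `∑
|k_j|` is at most the degree `s`; non-resonance then forces `k = 0`. -/
theorem diag_of_nonResonant {ω : Fin n → ℝ} {s : ℕ} (hω : NonResonantUpTo ω s)
    {m : Fin n ⊕ Fin n →₀ ℕ} (hm : m.degree = s) (h0 : ∑ i, m i * coordFreq ω i = 0) (j : Fin n) :
    m (Sum.inl j) = m (Sum.inr j) := by
  set k : Fin n → ℤ := fun j => (m (Sum.inl j) : ℤ) - m (Sum.inr j) with hk
  have hsum : ∑ j, (k j : ℝ) * ω j = 0 := by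
    rw [← h0, Fintype.sum_sum_type, ← Finset.sum_add_distrib]
    refine Finset.sum_congr rfl fun j _ => ?_
    simp only [hk, coordFreq, Sum.elim_inl, Sum.elim_inr]
    push_cast; ring
  have hle : ∑ j, |k j| ≤ (s : ℤ) := by
    rw [← hm, Finsupp.degree_eq_sum, Fintype.sum_sum_type, ← Finset.sum_add_distrib]
    push_cast
    refine Finset.sum_le_sum fun j _ => ?_
    simp only [hk]
    rw [abs_le]
    constructor <;> omega
  have hzero : ¬ 0 < ∑ j, |k j| := fun hpos => hω k hpos hle hsum
  have hz : ∑ j, |k j| = 0 :=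
    le_antisymm (not_lt.mp hzero) (Finset.sum_nonneg fun _ _ => abs_nonneg _)
  have := (Finset.sum_eq_zero_iff_of_nonneg (fun _ _ => abs_nonneg _)).mp hz j (Finset.mem_univ j)
  have hkj : (m (Sum.inl j) : ℤ) - m (Sum.inr j) = 0 := abs_eq_zero.mp this
  omega

/-- The homological equation: a homogeneous polynomial is the sum of `{H₀, χ}` and a polynomial in
normal form. -/
theorem exists_homological_solution (ω : Fin n → ℝ) {s : ℕ}
    {f : MvPolynomial (Fin n ⊕ Fin n) ℝ} (hf : f.IsHomogeneous s) :
    ∃ χ Z : MvPolynomial (Fin n ⊕ Fin n) ℝ, χ.IsHomogeneous s ∧ Z.IsHomogeneous s ∧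
      f = oscDerivation ω χ + Z ∧ oscDerivation ω Z = 0 ∧
      (NonResonantUpTo ω s → ∃ W : MvPolynomial (Fin n) ℝ, Z = aeval actionPoly W) := by
  obtain ⟨g, hg, hgf⟩ := exists_aeval_complexCoord_eq hf
  have hfsum : f = ∑ m ∈ g.support, rePart (C (coeff m g) * complexMonomial m) := by
    rw [← rePart_map f, ← hgf]
    conv_lhs => rw [g.as_sum]
    simp only [map_sum, aeval_complexCoord_monomial]
  have hterm : ∀ m ∈ g.support, ∃ χ Z : MvPolynomial (Fin n ⊕ Fin n) ℝ,
      χ.IsHomogeneous s ∧ Z.IsHomogeneous s ∧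
      rePart (C (coeff m g) * complexMonomial m) = oscDerivation ω χ + Z ∧
      oscDerivation ω Z = 0 ∧
      (NonResonantUpTo ω s → ∃ W : MvPolynomial (Fin n) ℝ, Z = aeval actionPoly W) := by
    intro m hm
    have hdeg : m.degree = s := by
      by_contra hne
      exact (mem_support_iff.mp hm) (hg.coeff_eq_zero hne)
    have hhom : ∀ c : ℂ, (rePart (C c * complexMonomial m)).IsHomogeneous s := fun c =>
      isHomogeneous_rePart (hdeg ▸ (isHomogeneous_complexMonomial m).C_mul c)
    have hL : ∀ c : ℂ, oscDerivation ω (rePart (C c * complexMonomial m)) =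
        rePart (C (c * (Complex.I * ((∑ i, m i * coordFreq ω i : ℝ) : ℂ))) *
          complexMonomial m) := by
      intro c
      rw [← rePart_oscDerivation, derivation_C_mul_eq, oscDerivation_complexMonomial, C_mul (a := c),
        mul_assoc]
    -- A resonant monomial lies in the kernel of `L` and goes into `Z`; any other is divided by its
    -- nonzero eigenvalue and goes into `χ`.
    by_cases h0 : (∑ i, m i * coordFreq ω i : ℝ) = 0
    · refine ⟨0, rePart (C (coeff m g) * complexMonomial m), isHomogeneous_zero _ _ _, hhom _,
        by simp, by rw [hL, h0]; simp, fun hω => ?_⟩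
      rw [complexMonomial_eq_of_diag (diag_of_nonResonant hω hdeg h0), rePart_C_mul_map]
      exact ⟨C (coeff m g).re * ∏ j : Fin n, (C 2 * X j) ^ m (Sum.inl j), by
        rw [map_mul, aeval_C, algebraMap_eq]⟩
    · refine ⟨rePart (C (coeff m g / (Complex.I * ((∑ i, m i * coordFreq ω i : ℝ) : ℂ))) *
        complexMonomial m), 0, hhom _, isHomogeneous_zero _ _ _, ?_, map_zero _,
        fun _ => ⟨0, by simp⟩⟩
      rw [hL, div_mul_cancel₀, add_zero]
      exact mul_ne_zero Complex.I_ne_zero (Complex.ofReal_ne_zero.mpr h0)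
  choose! χ Z hχ hZ hsum hLZ hW using hterm
  refine ⟨∑ m ∈ g.support, χ m, ∑ m ∈ g.support, Z m, IsHomogeneous.sum _ _ _ hχ,
    IsHomogeneous.sum _ _ _ hZ, ?_, ?_, fun hω => ?_⟩
  · rw [hfsum, map_sum, ← Finset.sum_add_distrib]
    exact Finset.sum_congr rfl hsum
  · rw [map_sum]
    exact Finset.sum_eq_zero hLZ
  · choose! W hW using fun m hm => hW m hm hω
    exact ⟨∑ m ∈ g.support, W m, by rw [map_sum]; exact Finset.sum_congr rfl hW⟩

end Homological

/-! ### Polynomials as functions on phase space, and their brackets with `H₀`. -/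

section PolyFun

variable {n : ℕ}

@[simp] theorem polyFun_C (a : ℝ) (z : Phase n) : polyFun (C a) z = a := by simp [polyFun]

@[simp] theorem polyFun_X (i : Fin n ⊕ Fin n) (z : Phase n) : polyFun (X i) z = z i := by
  simp [polyFun]

@[simp] theorem polyFun_add (p q : MvPolynomial (Fin n ⊕ Fin n) ℝ) (z : Phase n) :
    polyFun (p + q) z = polyFun p z + polyFun q z := by simp [polyFun]

@[simp] theorem polyFun_sub (p q : MvPolynomial (Fin n ⊕ Fin n) ℝ) (z : Phase n) :
    polyFun (p - q) z = polyFun p z - polyFun q z := by simp [polyFun]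

@[simp] theorem polyFun_mul (p q : MvPolynomial (Fin n ⊕ Fin n) ℝ) (z : Phase n) :
    polyFun (p * q) z = polyFun p z * polyFun q z := by simp [polyFun]

@[simp] theorem polyFun_pow (p : MvPolynomial (Fin n ⊕ Fin n) ℝ) (k : ℕ) (z : Phase n) :
    polyFun (p ^ k) z = polyFun p z ^ k := by simp [polyFun]

@[simp] theorem polyFun_sum {ι : Type*} (s : Finset ι) (p : ι → MvPolynomial (Fin n ⊕ Fin n) ℝ)
    (z : Phase n) : polyFun (∑ i ∈ s, p i) z = ∑ i ∈ s, polyFun (p i) z := by simp [polyFun]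

theorem analyticOnNhd_polyFun (p : MvPolynomial (Fin n ⊕ Fin n) ℝ) :
    AnalyticOnNhd ℝ (polyFun p) Set.univ := by
  have h := AnalyticOnNhd.eval_continuousLinearMap'
    (fun i => (EuclideanSpace.proj i : Phase n →L[ℝ] ℝ)) p
  exact h

theorem contDiff_polyFun {m : WithTop ℕ∞} (p : MvPolynomial (Fin n ⊕ Fin n) ℝ) :
    ContDiff ℝ m (polyFun p) :=
  contDiff_iff_contDiffAt.mpr fun z => (analyticOnNhd_polyFun p z trivial).contDiffAt

theorem differentiable_polyFun (p : MvPolynomial (Fin n ⊕ Fin n) ℝ) :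
    Differentiable ℝ (polyFun p) :=
  (contDiff_polyFun (m := 1) p).differentiable one_ne_zero

theorem partialDeriv_polyFun (i : Fin n ⊕ Fin n) (p : MvPolynomial (Fin n ⊕ Fin n) ℝ)
    (z : Phase n) : partialDeriv i (polyFun p) z = polyFun (pderiv i p) z := by
  classical
  induction p using MvPolynomial.induction_on with
  | C a =>
    have : polyFun (n := n) (C a) = fun _ => a := by ext z; simp
    rw [partialDeriv, this, pderiv_C]
    simp [polyFun]
  | add p q hp hq =>
    have : polyFun (p + q) = polyFun p + polyFun q := by ext z; simp
    rw [map_add, polyFun_add, ← hp, ← hq, partialDeriv, this,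
      fderiv_add (differentiable_polyFun p z) (differentiable_polyFun q z)]
    rfl
  | mul_X p j hp =>
    have hfun : polyFun (p * X j) = polyFun p * fun z => EuclideanSpace.proj (𝕜 := ℝ) j z := by
      ext z; simp
    rw [partialDeriv, hfun, fderiv_mul (differentiable_polyFun p z)
      (EuclideanSpace.proj (𝕜 := ℝ) j).differentiableAt, ContinuousLinearMap.fderiv]
    rw [partialDeriv] at hp
    rw [Derivation.leibniz, pderiv_X]
    simp only [_root_.add_apply, _root_.smul_apply, smul_eq_mul, hp,
      polyFun_add, polyFun_mul, polyFun_X]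
    congr 2
    rcases eq_or_ne j i with rfl | h
    · simp [polyFun]
    · simp [polyFun, h]

theorem C_half_mul_two {σ : Type*} : (C (1 / 2 : ℝ) * 2 : MvPolynomial σ ℝ) = 1 := by
  rw [← map_ofNat C 2, ← C_mul]; norm_num

/-- The harmonic oscillator as a polynomial. -/
def oscPoly (ω : Fin n → ℝ) : MvPolynomial (Fin n ⊕ Fin n) ℝ := ∑ j, C (ω j) * actionPoly j

theorem polyFun_actionPoly (j : Fin n) : polyFun (actionPoly j) = action j := by
  ext z
  simp only [actionPoly, polyFun_mul, polyFun_C, polyFun_add, polyFun_pow, polyFun_X, action]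
  ring

theorem polyFun_oscPoly (ω : Fin n → ℝ) : polyFun (oscPoly ω) = harmonicOscillator ω := by
  ext z
  simp [oscPoly, harmonicOscillator, polyFun_actionPoly]

theorem pderiv_inl_oscPoly (ω : Fin n → ℝ) (j : Fin n) :
    pderiv (Sum.inl j) (oscPoly ω) = C (ω j) * X (Sum.inl j) := by
  classical
  rw [oscPoly, map_sum, Finset.sum_eq_single j]
  · rw [actionPoly, derivation_C_mul_eq, derivation_C_mul_eq, map_add, Derivation.leibniz_pow,
      Derivation.leibniz_pow, pderiv_X_self, pderiv_X_of_ne (by simp)]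
    simp only [smul_eq_mul, mul_zero, smul_zero, zero_add, nsmul_eq_mul]
    push_cast
    linear_combination C (ω j) * X (Sum.inl j) * C_half_mul_two (σ := Fin n ⊕ Fin n)
  · intro b _ hb
    rw [actionPoly, derivation_C_mul_eq, derivation_C_mul_eq, map_add, Derivation.leibniz_pow,
      Derivation.leibniz_pow, pderiv_X_of_ne (by simp), pderiv_X_of_ne (by simpa using hb)]
    simp
  · simp

theorem pderiv_inr_oscPoly (ω : Fin n → ℝ) (j : Fin n) :
    pderiv (Sum.inr j) (oscPoly ω) = C (ω j) * X (Sum.inr j) := by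
  classical
  rw [oscPoly, map_sum, Finset.sum_eq_single j]
  · rw [actionPoly, derivation_C_mul_eq, derivation_C_mul_eq, map_add, Derivation.leibniz_pow,
      Derivation.leibniz_pow, pderiv_X_self, pderiv_X_of_ne (by simp)]
    simp only [smul_eq_mul, mul_zero, smul_zero, add_zero, nsmul_eq_mul]
    push_cast
    linear_combination C (ω j) * X (Sum.inr j) * C_half_mul_two (σ := Fin n ⊕ Fin n)
  · intro b _ hb
    rw [actionPoly, derivation_C_mul_eq, derivation_C_mul_eq, map_add, Derivation.leibniz_pow,
      Derivation.leibniz_pow, pderiv_X_of_ne (by simpa using hb), pderiv_X_of_ne (by simp)]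
    simp
  · simp

theorem oscDerivation_eq_sum (ω : Fin n → ℝ) (p : MvPolynomial (Fin n ⊕ Fin n) ℝ) :
    oscDerivation ω p = ∑ j, (C (ω j) * X (Sum.inl j) * pderiv (Sum.inr j) p -
      C (ω j) * X (Sum.inr j) * pderiv (Sum.inl j) p) := by
  classical
  induction p using MvPolynomial.induction_on with
  | C a => simp [derivation_C]
  | add p q hp hq =>
    rw [map_add, hp, hq, ← Finset.sum_add_distrib]
    refine Finset.sum_congr rfl fun j _ => ?_
    rw [map_add, map_add]; ring
  | mul_X p i hp =>
    have hX : oscDerivation ω (X i) = ∑ j, (C (ω j) * X (Sum.inl j) * pderiv (Sum.inr j) (X i) -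
        C (ω j) * X (Sum.inr j) * pderiv (Sum.inl j) (X i)) := by
      rcases i with i | i
      · rw [oscDerivation_inl, Finset.sum_eq_single i]
        · rw [pderiv_X_self, pderiv_X_of_ne (by simp)]; ring
        · intro b _ hb
          rw [pderiv_X_of_ne (by simp), pderiv_X_of_ne (by simpa using fun h => hb h.symm)]; ring
        · simp
      · rw [oscDerivation_inr, Finset.sum_eq_single i]
        · rw [pderiv_X_self, pderiv_X_of_ne (by simp)]; ring
        · intro b _ hb
          rw [pderiv_X_of_ne (by simpa using fun h => hb h.symm), pderiv_X_of_ne (by simp)]; ring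
        · simp
    rw [Derivation.leibniz, hp, hX, smul_eq_mul, smul_eq_mul, Finset.mul_sum, Finset.mul_sum,
      ← Finset.sum_add_distrib]
    refine Finset.sum_congr rfl fun j _ => ?_
    rw [Derivation.leibniz, Derivation.leibniz]
    simp only [smul_eq_mul]
    ring

theorem poissonBracket_polyFun_harmonicOscillator (ω : Fin n → ℝ)
    (p : MvPolynomial (Fin n ⊕ Fin n) ℝ) (z : Phase n) :
    poissonBracket (polyFun p) (harmonicOscillator ω) z = -polyFun (oscDerivation ω p) z := by
  rw [← polyFun_oscPoly, oscDerivation_eq_sum, polyFun_sum, ← Finset.sum_neg_distrib,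
    poissonBracket]
  refine Finset.sum_congr rfl fun j _ => ?_
  simp only [partialDeriv_polyFun, pderiv_inl_oscPoly, pderiv_inr_oscPoly, polyFun_sub,
    polyFun_mul, polyFun_C, polyFun_X]
  ring

end PolyFun

/-! ### Polynomial canonical transformations. -/

section Canonical

variable {n : ℕ}

/-- A bijection of phase space which acts on polynomials as the algebra endomorphism `T`, has
polynomial inverse and preserves the Poisson bracket. -/
structure IsPolyCanonical (τ : Phase n ≃ Phase n)
    (T : MvPolynomial (Fin n ⊕ Fin n) ℝ →ₐ[ℝ] MvPolynomial (Fin n ⊕ Fin n) ℝ) : Prop where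
  polyFun_comp : ∀ p z, polyFun (T p) z = polyFun p (τ z)
  exists_symm : ∃ S : MvPolynomial (Fin n ⊕ Fin n) ℝ →ₐ[ℝ] MvPolynomial (Fin n ⊕ Fin n) ℝ,
    ∀ p z, polyFun (S p) z = polyFun p (τ.symm z)
  bracket : ∀ (F G : Phase n → ℝ) (z : Phase n), DifferentiableAt ℝ F (τ z) →
    DifferentiableAt ℝ G (τ z) → poissonBracket F G (τ z) = poissonBracket (F ∘ τ) (G ∘ τ) z

theorem analyticOnNhd_of_polyFun_comp {g : Phase n → Phase n}
    {S : MvPolynomial (Fin n ⊕ Fin n) ℝ →ₐ[ℝ] MvPolynomial (Fin n ⊕ Fin n) ℝ}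
    (h : ∀ p z, polyFun (S p) z = polyFun p (g z)) : AnalyticOnNhd ℝ g Set.univ := by
  have hg : g = fun z => (EuclideanSpace.equiv (Fin n ⊕ Fin n) ℝ).symm
      (fun i => polyFun (S (X i)) z) := by
    ext z i
    simp [h]
  rw [hg]
  intro z hz
  exact ((EuclideanSpace.equiv (Fin n ⊕ Fin n) ℝ).symm.toContinuousLinearMap.analyticAt _).comp
    (analyticAt_pi_iff.mpr fun i => analyticOnNhd_polyFun (S (X i)) z trivial)

namespace IsPolyCanonical

variable {τ τ' : Phase n ≃ Phase n}
  {T T' : MvPolynomial (Fin n ⊕ Fin n) ℝ →ₐ[ℝ] MvPolynomial (Fin n ⊕ Fin n) ℝ}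

theorem analytic (h : IsPolyCanonical τ T) : AnalyticOnNhd ℝ τ Set.univ :=
  analyticOnNhd_of_polyFun_comp h.polyFun_comp

theorem analytic_symm (h : IsPolyCanonical τ T) : AnalyticOnNhd ℝ τ.symm Set.univ :=
  analyticOnNhd_of_polyFun_comp h.exists_symm.choose_spec

theorem refl : IsPolyCanonical (Equiv.refl (Phase n)) (AlgHom.id ℝ _) where
  polyFun_comp _ _ := rfl
  exists_symm := ⟨AlgHom.id ℝ _, fun _ _ => rfl⟩
  bracket _ _ _ _ _ := rfl

theorem trans (h : IsPolyCanonical τ T) (h' : IsPolyCanonical τ' T') :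
    IsPolyCanonical (τ'.trans τ) (T'.comp T) where
  polyFun_comp p z := by simp [h'.polyFun_comp, h.polyFun_comp]
  exists_symm := by
    obtain ⟨S, hS⟩ := h.exists_symm
    obtain ⟨S', hS'⟩ := h'.exists_symm
    exact ⟨S.comp S', fun p z => by simp [hS, hS']⟩
  bracket F G z hF hG := by
    have hd : DifferentiableAt ℝ τ (τ' z) := (h.analytic _ trivial).differentiableAt
    have hF' : DifferentiableAt ℝ (F ∘ τ) (τ' z) := DifferentiableAt.comp (τ' z) hF hd
    have hG' : DifferentiableAt ℝ (G ∘ τ) (τ' z) := DifferentiableAt.comp (τ' z) hG hd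
    exact (h.bracket F G (τ' z) hF hG).trans (h'.bracket _ _ z hF' hG')

end IsPolyCanonical

end Canonical

/-! ### Shears generated by powers of linear forms. -/

section Shear

variable {n : ℕ}

/-- The symplectic gradient of the linear form with coefficients `a`. -/
def symplGrad (a : Fin n ⊕ Fin n → ℝ) : Phase n :=
  WithLp.toLp 2 (Sum.elim (fun j => a (Sum.inr j)) (fun j => -a (Sum.inl j)))

@[simp] theorem symplGrad_inl (a : Fin n ⊕ Fin n → ℝ) (j : Fin n) :
    symplGrad a (Sum.inl j) = a (Sum.inr j) := rfl

@[simp] theorem symplGrad_inr (a : Fin n ⊕ Fin n → ℝ) (j : Fin n) :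
    symplGrad a (Sum.inr j) = -a (Sum.inl j) := rfl

/-- The linear form with coefficients `a`. -/
def linForm (a : Fin n ⊕ Fin n → ℝ) : Phase n →L[ℝ] ℝ :=
  ∑ i, a i • EuclideanSpace.proj (𝕜 := ℝ) i

theorem linForm_apply (a : Fin n ⊕ Fin n → ℝ) (z : Phase n) : linForm a z = ∑ i, a i * z i := by
  simp [linForm]

theorem linForm_symplGrad (a : Fin n ⊕ Fin n → ℝ) : linForm a (symplGrad a) = 0 := by
  rw [linForm_apply, Fintype.sum_sum_type, ← Finset.sum_add_distrib]
  refine Finset.sum_eq_zero fun j _ => ?_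
  rw [symplGrad_inl, symplGrad_inr]; ring

theorem linForm_single (a : Fin n ⊕ Fin n → ℝ) (i : Fin n ⊕ Fin n) :
    linForm a (EuclideanSpace.single i 1) = a i := by
  classical
  simp [linForm_apply]

/-- The time-`t` flow of the Hamiltonian `ℓ ^ (k + 1) / (k + 1)` with `ℓ` a linear form. -/
def shearFun (a : Fin n ⊕ Fin n → ℝ) (k : ℕ) (t : ℝ) (z : Phase n) : Phase n :=
  z + (t * linForm a z ^ k) • symplGrad a

theorem linForm_shearFun (a : Fin n ⊕ Fin n → ℝ) (k : ℕ) (t : ℝ) (z : Phase n) :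
    linForm a (shearFun a k t z) = linForm a z := by
  rw [shearFun, map_add, map_smul, linForm_symplGrad, smul_zero, add_zero]

theorem shearFun_shearFun (a : Fin n ⊕ Fin n → ℝ) (k : ℕ) (t u : ℝ) (z : Phase n) :
    shearFun a k u (shearFun a k t z) = shearFun a k (t + u) z := by
  rw [shearFun, linForm_shearFun, shearFun, shearFun, add_assoc, ← add_smul]
  congr 2; ring

theorem shearFun_zero (a : Fin n ⊕ Fin n → ℝ) (k : ℕ) (z : Phase n) : shearFun a k 0 z = z := by
  simp [shearFun]

/-- The shear as a bijection of phase space. -/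
def shear (a : Fin n ⊕ Fin n → ℝ) (k : ℕ) (t : ℝ) : Phase n ≃ Phase n where
  toFun := shearFun a k t
  invFun := shearFun a k (-t)
  left_inv z := by rw [shearFun_shearFun, add_neg_cancel, shearFun_zero]
  right_inv z := by rw [shearFun_shearFun, neg_add_cancel, shearFun_zero]

/-- The action of a shear on polynomials. -/
def shearHom (a : Fin n ⊕ Fin n → ℝ) (k : ℕ) (t : ℝ) :
    MvPolynomial (Fin n ⊕ Fin n) ℝ →ₐ[ℝ] MvPolynomial (Fin n ⊕ Fin n) ℝ :=
  aeval fun i => X i + C (t * symplGrad a i) * (∑ i, a i • X i) ^ k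

theorem polyFun_linForm (a : Fin n ⊕ Fin n → ℝ) (z : Phase n) :
    polyFun (∑ i, a i • X i) z = linForm a z := by
  simp [linForm_apply, smul_eq_C_mul]

theorem polyFun_shearHom (a : Fin n ⊕ Fin n → ℝ) (k : ℕ) (t : ℝ)
    (p : MvPolynomial (Fin n ⊕ Fin n) ℝ) (z : Phase n) :
    polyFun (shearHom a k t p) z = polyFun p (shearFun a k t z) := by
  induction p using MvPolynomial.induction_on with
  | C a => simp [shearHom, algebraMap_eq]
  | add p q hp hq => simp [hp, hq]
  | mul_X p i hp =>
    rw [map_mul, polyFun_mul, hp, polyFun_mul, polyFun_X]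
    congr 1
    rw [shearHom, aeval_X, polyFun_add, polyFun_mul, polyFun_pow, polyFun_linForm]
    simp [shearFun]
    ring

/-- The right-hand side is `{F, ℓ}`, the only quantity through which a shear alters the gradient of
`F`. -/
theorem fderiv_symplGrad (a : Fin n ⊕ Fin n → ℝ) (F : Phase n → ℝ) (z : Phase n) :
    fderiv ℝ F z (symplGrad a) = ∑ j, (a (Sum.inr j) * partialDeriv (Sum.inl j) F z -
      a (Sum.inl j) * partialDeriv (Sum.inr j) F z) := by
  classical
  have h : symplGrad a = ∑ i, symplGrad a i • EuclideanSpace.single i (1 : ℝ) := by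
    ext i
    rw [WithLp.ofLp_sum, Finset.sum_apply, Finset.sum_eq_single i]
    · simp
    · intro b _ hb
      simp [hb.symm]
    · simp
  rw [h, map_sum, Fintype.sum_sum_type, ← Finset.sum_add_distrib]
  refine Finset.sum_congr rfl fun j _ => ?_
  simp only [map_smul, symplGrad_inl, symplGrad_inr, smul_eq_mul, partialDeriv]
  ring

theorem partialDeriv_comp_shearFun (a : Fin n ⊕ Fin n → ℝ) (k : ℕ) (t : ℝ) {F : Phase n → ℝ}
    {z : Phase n} (hF : DifferentiableAt ℝ F (shearFun a k t z)) (i : Fin n ⊕ Fin n) :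
    partialDeriv i (F ∘ shearFun a k t) z = partialDeriv i F (shearFun a k t z) +
      t * (k * linForm a z ^ (k - 1)) * a i * fderiv ℝ F (shearFun a k t z) (symplGrad a) := by
  have h1 : HasFDerivAt (fun z => t * linForm a z ^ k)
      (t • ((k * linForm a z ^ (k - 1)) • linForm a)) z := by
    have := (((linForm a).hasFDerivAt (x := z)).pow k).const_mul t
    simpa using this
  have h2 : HasFDerivAt (shearFun a k t) (ContinuousLinearMap.id ℝ (Phase n) +
      (t • ((k * linForm a z ^ (k - 1)) • linForm a)).smulRight (symplGrad a)) z :=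
    (hasFDerivAt_id z).add (h1.smul_const (symplGrad a))
  rw [partialDeriv, (hF.hasFDerivAt.comp z h2).fderiv]
  simp only [ContinuousLinearMap.comp_apply, _root_.add_apply,
    ContinuousLinearMap.smulRight_apply, _root_.smul_apply, linForm_single,
    ContinuousLinearMap.id_apply, map_add, map_smul, smul_eq_mul, partialDeriv]
  ring

theorem isPolyCanonical_shear (a : Fin n ⊕ Fin n → ℝ) (k : ℕ) (t : ℝ) :
    IsPolyCanonical (shear a k t) (shearHom a k t) where
  polyFun_comp p z := polyFun_shearHom a k t p z
  exists_symm := ⟨shearHom a k (-t), fun p z => polyFun_shearHom a k (-t) p z⟩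
  bracket F G z hF hG := by
    change poissonBracket F G (shearFun a k t z) =
      poissonBracket (F ∘ shearFun a k t) (G ∘ shearFun a k t) z
    change DifferentiableAt ℝ F (shearFun a k t z) at hF
    change DifferentiableAt ℝ G (shearFun a k t z) at hG
    have hF' := fderiv_symplGrad a F (shearFun a k t z)
    have hG' := fderiv_symplGrad a G (shearFun a k t z)
    simp only [poissonBracket, partialDeriv_comp_shearFun a k t hF,
      partialDeriv_comp_shearFun a k t hG]
    set w := shearFun a k t z
    set c := t * (k * linForm a z ^ (k - 1))
    set f := fderiv ℝ F w (symplGrad a)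
    set g := fderiv ℝ G w (symplGrad a)
    -- The shear adds `c {F, ℓ} a` to the gradient of `F` and `c {G, ℓ} a` to that of `G`. The terms
    -- in `c²` cancel for each `j`; those linear in `c` sum to `c {G, ℓ} {F, ℓ} - c {F, ℓ} {G, ℓ} =
    -- 0`.
    have key : ∀ j : Fin n,
        (partialDeriv (Sum.inl j) F w + c * a (Sum.inl j) * f) *
            (partialDeriv (Sum.inr j) G w + c * a (Sum.inr j) * g) -
          (partialDeriv (Sum.inr j) F w + c * a (Sum.inr j) * f) *
            (partialDeriv (Sum.inl j) G w + c * a (Sum.inl j) * g) =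
        (partialDeriv (Sum.inl j) F w * partialDeriv (Sum.inr j) G w -
          partialDeriv (Sum.inr j) F w * partialDeriv (Sum.inl j) G w) +
        (c * g * (a (Sum.inr j) * partialDeriv (Sum.inl j) F w -
            a (Sum.inl j) * partialDeriv (Sum.inr j) F w) -
          c * f * (a (Sum.inr j) * partialDeriv (Sum.inl j) G w -
            a (Sum.inl j) * partialDeriv (Sum.inr j) G w)) := by
      intro j; ring
    rw [Finset.sum_congr rfl fun j _ => key j, Finset.sum_add_distrib, left_eq_add,
      Finset.sum_sub_distrib, ← Finset.mul_sum, ← Finset.mul_sum, ← hF', ← hG']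
    ring

theorem isHomogeneous_linForm (a : Fin n ⊕ Fin n → ℝ) :
    (∑ i, a i • X i : MvPolynomial (Fin n ⊕ Fin n) ℝ).IsHomogeneous 1 :=
  IsHomogeneous.sum _ _ _ fun i _ => by
    rw [smul_eq_C_mul]; exact isHomogeneous_C_mul_X _ _

theorem shearHom_X_sub_mem (a : Fin n ⊕ Fin n → ℝ) (k : ℕ) (t : ℝ) (i : Fin n ⊕ Fin n) :
    shearHom a k t (X i) - X i ∈ idealOfVars (Fin n ⊕ Fin n) ℝ ^ k := by
  rw [shearHom, aeval_X, add_sub_cancel_left]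
  refine Ideal.mul_mem_left _ _ (mem_pow_idealOfVars_of_isHomogeneous ?_)
  simpa only [one_mul] using (isHomogeneous_linForm a).pow k

/-- As `H₀` is quadratic, its expansion along the shear stops at second order, with remainder a
constant times `(ℓ ^ k) ^ 2`. The time `(k + 1) t` compensates the generator `ℓ ^ (k + 1) / (k +
1)`, so that the first-order term is `L (t ℓ ^ (k + 1))`. -/
theorem shearHom_oscPoly_sub_mem (ω : Fin n → ℝ) (a : Fin n ⊕ Fin n → ℝ) (k : ℕ) (t : ℝ) :
    shearHom a k ((k + 1) * t) (oscPoly ω) - oscPoly ω -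
      oscDerivation ω (t • (∑ i, a i • X i) ^ (k + 1)) ∈
        idealOfVars (Fin n ⊕ Fin n) ℝ ^ (k * 2) := by
  set l : MvPolynomial (Fin n ⊕ Fin n) ℝ := ∑ i, a i • X i with hl
  have hL : oscDerivation ω l =
      ∑ j, C (ω j) * (C (a (Sum.inr j)) * X (Sum.inl j) - C (a (Sum.inl j)) * X (Sum.inr j)) := by
    rw [hl, map_sum, Fintype.sum_sum_type, ← Finset.sum_add_distrib]
    refine Finset.sum_congr rfl fun j _ => ?_
    rw [Derivation.map_smul, Derivation.map_smul, oscDerivation_inl, oscDerivation_inr, smul_eq_C_mul, smul_eq_C_mul]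
    ring
  have key : shearHom a k ((k + 1) * t) (oscPoly ω) - oscPoly ω -
      oscDerivation ω (t • l ^ (k + 1)) =
      (∑ j, C (ω j) * (C (1 / 2) * (C ((k + 1) * t) ^ 2 *
        (C (a (Sum.inr j)) ^ 2 + C (a (Sum.inl j)) ^ 2)))) * (l ^ k) ^ 2 := by
    rw [Derivation.map_smul, Derivation.leibniz_pow, hL, oscPoly, map_sum, Finset.sum_mul, Nat.add_sub_cancel,
      smul_eq_C_mul, smul_eq_mul, Finset.mul_sum, nsmul_eq_mul, Finset.mul_sum, Finset.mul_sum,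
      ← Finset.sum_sub_distrib, ← Finset.sum_sub_distrib]
    refine Finset.sum_congr rfl fun j _ => ?_
    simp only [actionPoly, map_mul, map_add, map_pow]
    simp only [shearHom, aeval_X, ← algebraMap_eq, AlgHom.commutes]
    simp only [algebraMap_eq, ← hl, symplGrad_inl, symplGrad_inr, C_mul, C_add, C_neg, map_natCast,
      C_1]
    push_cast
    linear_combination (C (ω j) * C t * (k + 1) * l ^ k *
      (C (a (Sum.inr j)) * X (Sum.inl j) - C (a (Sum.inl j)) * X (Sum.inr j))) * C_half_mul_two (σ := Fin n ⊕ Fin n)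
  rw [key, ← pow_mul]
  refine Ideal.mul_mem_left _ _ (mem_pow_idealOfVars_of_isHomogeneous ?_)
  simpa only [one_mul] using (isHomogeneous_linForm a).pow (k * 2)

/-- Every homogeneous generator of degree at least three is realized, to leading order, by a
polynomial canonical transformation. -/
theorem exists_isPolyCanonical_of_generator (ω : Fin n → ℝ) {k : ℕ} (hk : 1 ≤ k)
    {χ : MvPolynomial (Fin n ⊕ Fin n) ℝ} (hχ : χ.IsHomogeneous (k + 2)) :
    ∃ τ T, IsPolyCanonical τ T ∧
      (∀ i, T (X i) - X i ∈ idealOfVars (Fin n ⊕ Fin n) ℝ ^ (k + 1)) ∧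
      T (oscPoly ω) - oscPoly ω - oscDerivation ω χ ∈
        idealOfVars (Fin n ⊕ Fin n) ℝ ^ (k + 3) := by
  classical
  -- One shear per power of a linear form; their first-order effects on `H₀` add up to `L χ`.
  obtain ⟨c, rfl⟩ := (Finsupp.mem_span_range_iff_exists_finsupp).mp (mem_span_pow_linearForm hχ)
  rw [Finsupp.sum]
  clear hχ
  induction c.support using Finset.induction_on with
  | empty => exact ⟨_, _, IsPolyCanonical.refl, by simp, by simp⟩
  | insert a s ha ih =>
    obtain ⟨τ, T, hτ, hT, hT0⟩ := ih
    set χ := ∑ a ∈ s, c a • (∑ i, a i • (X i : MvPolynomial (Fin n ⊕ Fin n) ℝ)) ^ (k + 2) with hχ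
    have hχhom : χ.IsHomogeneous (k + 2) := by
      refine IsHomogeneous.sum _ _ _ fun b _ => ?_
      rw [smul_eq_C_mul]
      simpa only [one_mul] using ((isHomogeneous_linForm b).pow (k + 2)).C_mul (c b)
    have hLχ := mem_pow_idealOfVars_of_isHomogeneous (isHomogeneous_oscDerivation ω hχhom)
    set S := shearHom a (k + 1) (((k + 1 : ℕ) + 1) * c a) with hSdef
    have hS : ∀ i, S (X i) - X i ∈ idealOfVars (Fin n ⊕ Fin n) ℝ ^ (k + 1) :=
      shearHom_X_sub_mem a (k + 1) _
    have hS0 := shearHom_oscPoly_sub_mem ω a (k + 1) (c a)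
    refine ⟨_, _, hτ.trans (isPolyCanonical_shear a (k + 1) (((k + 1 : ℕ) + 1) * c a)), ?_, ?_⟩
    · intro i
      have h1 := Ideal.pow_le_pow_right (Nat.le_add_right (k + 1) k)
        (algHom_sub_self_mem hS (hT i))
      have h2 := add_mem (add_mem h1 (hT i)) (hS i)
      convert h2 using 1
      rw [AlgHom.comp_apply, map_sub]
      ring
    · have h1 := Ideal.pow_le_pow_right (Nat.le_add_right (k + 3) k)
        (algHom_sub_self_mem hS hT0)
      -- Both the interaction of the new shear with the earlier ones and its own quadratic remainder
      -- have order at least `k + 3` only because `k ≥ 1`, that is, because generators have degree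
      -- at least three.
      have h2 := Ideal.pow_le_pow_right (by omega : k + 3 ≤ k + 2 + k)
        (algHom_sub_self_mem hS hLχ)
      have h3 := Ideal.pow_le_pow_right (by omega : k + 3 ≤ (k + 1) * 2) hS0
      have h4 := add_mem (add_mem (add_mem h1 hT0) h2) h3
      convert h4 using 1
      rw [Finset.sum_insert ha, AlgHom.comp_apply, map_sub, map_sub, map_add]
      ring

end Shear

/-! ### Induction on the order of the normal form. -/

section NormalForm

variable {n : ℕ}

/-- Polynomial Birkhoff normal form of order `k + 2`. -/
theorem exists_polynomial_normalForm (ω : Fin n → ℝ) {f : MvPolynomial (Fin n ⊕ Fin n) ℝ}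
    (hf : f ∈ idealOfVars (Fin n ⊕ Fin n) ℝ ^ 3) (k : ℕ) :
    ∃ τ T Z, IsPolyCanonical τ T ∧
      (∀ i, T (X i) - X i ∈ idealOfVars (Fin n ⊕ Fin n) ℝ ^ 2) ∧
      T (oscPoly ω + f) - oscPoly ω - Z ∈ idealOfVars (Fin n ⊕ Fin n) ℝ ^ (k + 3) ∧
      Z ∈ idealOfVars (Fin n ⊕ Fin n) ℝ ^ 3 ∧ Z.totalDegree ≤ k + 2 ∧ oscDerivation ω Z = 0 ∧
      (NonResonantUpTo ω (k + 2) → ∃ W : MvPolynomial (Fin n) ℝ, Z = aeval actionPoly W) := by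
  induction k with
  | zero =>
    exact ⟨_, _, 0, IsPolyCanonical.refl, by simp, by simpa using hf, by simp, by simp, by simp,
      fun _ => ⟨0, by simp⟩⟩
  | succ k ih =>
    obtain ⟨τ, T, Z, hτ, hT, hg, hZ, hdeg, hLZ, hW⟩ := ih
    set g := T (oscPoly ω + f) - oscPoly ω - Z with hgdef
    obtain ⟨χ, Y, hχ, hY, hsolve, hLY, hWY⟩ :=
      exists_homological_solution ω (homogeneousComponent_isHomogeneous (k + 3) g)
    -- The generator `-χ` makes `H₀` contribute `-L χ`, which cancels the `L χ` in the lowest-order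
    -- part of `g` and leaves `Y`.
    obtain ⟨τ', S, hτ', hS, hS0⟩ :=
      exists_isPolyCanonical_of_generator ω (Nat.le_add_left 1 k) (χ := -χ) hχ.neg
    have hYmem := mem_pow_idealOfVars_of_isHomogeneous hY
    refine ⟨_, _, Z + Y, hτ.trans hτ', ?_, ?_, ?_, ?_, ?_, ?_⟩
    · intro i
      have h1 := Ideal.pow_le_pow_right (by omega : 2 ≤ 2 + (k + 1)) (algHom_sub_self_mem hS (hT i))
      have h2 := Ideal.pow_le_pow_right (by omega : 2 ≤ k + 1 + 1) (hS i)
      convert add_mem (add_mem h1 (hT i)) h2 using 1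
      rw [AlgHom.comp_apply, map_sub]
      ring
    · have h1 := Ideal.pow_le_pow_right (by omega : k + 1 + 3 ≤ 3 + (k + 1))
        (algHom_sub_self_mem hS hZ)
      have h2 := Ideal.pow_le_pow_right (by omega : k + 1 + 3 ≤ k + 3 + (k + 1))
        (algHom_sub_self_mem hS hg)
      have h3 := sub_homogeneousComponent_mem hg
      rw [hsolve] at h3
      convert add_mem (add_mem (add_mem hS0 h1) h2) h3 using 1
      have : T (oscPoly ω + f) = oscPoly ω + Z + g := by rw [hgdef]; ring
      rw [AlgHom.comp_apply, this, map_add, map_add, Derivation.map_neg]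
      ring
    · exact add_mem hZ (Ideal.pow_le_pow_right (by omega) hYmem)
    · exact (totalDegree_add _ _).trans (max_le (hdeg.trans (by omega)) hY.totalDegree_le)
    · rw [map_add, hLZ, hLY, add_zero]
    · intro hω
      obtain ⟨W, rfl⟩ := hW fun m hm hle => hω m hm (hle.trans (by push_cast; omega))
      obtain ⟨W', rfl⟩ := hWY hω
      exact ⟨W + W', (map_add _ _ _).symm⟩

end NormalForm

/-! ### Order of vanishing: ideal powers versus growth at the origin. -/

section Asymptotics

variable {n : ℕ}

theorem polyFun_isBigO {k : ℕ} {p : MvPolynomial (Fin n ⊕ Fin n) ℝ}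
    (hp : p ∈ idealOfVars (Fin n ⊕ Fin n) ℝ ^ k) :
    polyFun p =O[𝓝 0] fun z => ‖z‖ ^ k := by
  have h0 : ∀ p : MvPolynomial (Fin n ⊕ Fin n) ℝ, polyFun p =O[𝓝 0] fun _ => (1 : ℝ) := fun p =>
    (contDiff_polyFun (m := 0) p).continuous.continuousAt.isBigO_one ℝ
  have h1 : ∀ p ∈ idealOfVars (Fin n ⊕ Fin n) ℝ, polyFun p =O[𝓝 0] fun z => ‖z‖ := by
    intro p hp
    induction hp using Submodule.span_induction with
    | mem x hx =>
      obtain ⟨i, rfl⟩ := hx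
      refine Asymptotics.isBigO_of_le _ fun z => ?_
      rw [polyFun_X, norm_norm]
      exact PiLp.norm_apply_le z i
    | zero => exact (Asymptotics.isBigO_zero _ _).congr_left fun z => by simp [polyFun]
    | add p q _ _ hp hq => exact (hp.add hq).congr_left fun z => (polyFun_add p q z).symm
    | smul a q _ ih =>
      exact ((h0 a).mul ih).congr (fun z => (polyFun_mul a q z).symm) fun z => one_mul _
  induction k generalizing p with
  | zero => simpa using h0 p
  | succ k ih =>
    rw [pow_succ] at hp
    induction hp using Submodule.mul_induction_on' with
    | mem_mul_mem a ha b hb =>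
      exact ((ih ha).mul (h1 b hb)).congr (fun z => (polyFun_mul a b z).symm)
        fun z => (pow_succ _ _).symm
    | add p _ q _ hp hq => exact (hp.add hq).congr_left fun z => (polyFun_add p q z).symm

theorem isBigO_norm_pow_of_le {j k : ℕ} (h : j ≤ k) :
    (fun z : Phase n => ‖z‖ ^ k) =O[𝓝 0] fun z => ‖z‖ ^ j := by
  have h1 : (fun z : Phase n => ‖z‖ ^ (k - j)) =O[𝓝 0] fun _ => (1 : ℝ) := by
    have : Continuous fun z : Phase n => ‖z‖ ^ (k - j) := by fun_prop
    exact this.continuousAt.isBigO_one ℝ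
  exact (h1.mul (Asymptotics.isBigO_refl (fun z : Phase n => ‖z‖ ^ j) _)).congr
    (fun z => by rw [← pow_add, Nat.sub_add_cancel h]) fun z => one_mul _

theorem polyFun_smul {k : ℕ} {p : MvPolynomial (Fin n ⊕ Fin n) ℝ} (hp : p.IsHomogeneous k)
    (t : ℝ) (z : Phase n) : polyFun p (t • z) = t ^ k * polyFun p z := by
  rw [polyFun, polyFun, eval_eq', eval_eq', Finset.mul_sum]
  refine Finset.sum_congr rfl fun m hm => ?_
  have hdeg : m.degree = k := by
    by_contra hne
    exact (mem_support_iff.mp hm) (hp.coeff_eq_zero hne)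
  have : ∏ i, (t • z) i ^ m i = t ^ k * ∏ i, z i ^ m i := by
    rw [← hdeg, Finsupp.degree_eq_sum, ← Finset.prod_pow_eq_pow_sum, ← Finset.prod_mul_distrib]
    exact Finset.prod_congr rfl fun i _ => by rw [← mul_pow]; rfl
  rw [this]; ring

/-- Along a ray, `p (t z) = t ^ k p z` is `O(t ^ (k + 1))`; dividing by `t ^ k` and letting `t → 0⁺`
gives `p z = 0`. -/
theorem eq_zero_of_isHomogeneous_of_isBigO {k : ℕ} {p : MvPolynomial (Fin n ⊕ Fin n) ℝ}
    (hp : p.IsHomogeneous k) (hO : polyFun p =O[𝓝 0] fun z => ‖z‖ ^ (k + 1)) : p = 0 := by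
  apply MvPolynomial.funext
  intro v
  rw [map_zero]
  set z : Phase n := WithLp.toLp 2 v with hz
  have hv : eval v p = polyFun p z := rfl
  rw [hv]
  have hlim : Filter.Tendsto (fun t : ℝ => t • z) (𝓝[>] 0) (𝓝 0) := by
    have : Continuous fun t : ℝ => t • z := by fun_prop
    have h := this.tendsto 0
    rw [zero_smul] at h
    exact h.mono_left nhdsWithin_le_nhds
  have h1 : (fun t : ℝ => t ^ k * polyFun p z) =O[𝓝[>] 0] fun t => t ^ k * t := by
    refine (hO.comp_tendsto hlim).congr_left (fun t => polyFun_smul hp t z) |>.trans ?_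
    refine Asymptotics.IsBigO.of_bound (‖z‖ ^ (k + 1)) (Filter.Eventually.of_forall fun t => ?_)
    simp only [Function.comp_apply, norm_smul, norm_pow, norm_mul, norm_norm]
    rw [mul_pow, pow_succ ‖t‖]
    exact (mul_comm _ _).le
  have h2 : (fun _ : ℝ => polyFun p z) =O[𝓝[>] 0] fun t : ℝ => t := by
    obtain ⟨c, hc⟩ := h1.bound
    refine Asymptotics.IsBigO.of_bound c ?_
    filter_upwards [hc, self_mem_nhdsWithin] with t ht hpos
    have hpos' : 0 < ‖t ^ k‖ := norm_pos_iff.mpr (pow_ne_zero _ (ne_of_gt hpos))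
    rw [norm_mul, norm_mul, mul_left_comm] at ht
    exact le_of_mul_le_mul_left ht hpos'
  have h3 : Filter.Tendsto (fun _ : ℝ => polyFun p z) (𝓝[>] 0) (𝓝 0) :=
    h2.trans_tendsto (Filter.tendsto_id.mono_left nhdsWithin_le_nhds)
  exact tendsto_nhds_unique tendsto_const_nhds h3

/-- Homogeneous components are peeled off from the bottom: once `p ∈ 𝔪 ^ k`, its degree-`k`
component is itself `O(‖z‖ ^ (k + 1))`, hence zero. -/
theorem mem_pow_idealOfVars_of_isBigO {k : ℕ} {p : MvPolynomial (Fin n ⊕ Fin n) ℝ}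
    (hO : polyFun p =O[𝓝 0] fun z => ‖z‖ ^ k) : p ∈ idealOfVars (Fin n ⊕ Fin n) ℝ ^ k := by
  induction k with
  | zero => simp
  | succ k ih =>
    have h1 := sub_homogeneousComponent_mem (ih (hO.trans (isBigO_norm_pow_of_le (Nat.le_succ k))))
    have h2 : homogeneousComponent k p = 0 := by
      refine eq_zero_of_isHomogeneous_of_isBigO (homogeneousComponent_isHomogeneous k p) ?_
      exact (hO.sub (polyFun_isBigO h1)).congr_left fun z => by simp
    rwa [h2, sub_zero] at h1

end Asymptotics

/-! ### Smooth cut-off and Taylor polynomials. -/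

section Taylor

variable {n : ℕ}

/-- A function which is smooth near the origin agrees near the origin with a smooth function. -/
theorem exists_contDiff_eq_on_ball {f : Phase n → ℝ} {U : Set (Phase n)} (hU : IsOpen U)
    (h0 : (0 : Phase n) ∈ U) (hf : ContDiffOn ℝ ((⊤ : ℕ∞) : WithTop ℕ∞) f U) :
    ∃ g : Phase n → ℝ, ContDiff ℝ ((⊤ : ℕ∞) : WithTop ℕ∞) g ∧ ∃ ε > 0,
      Metric.ball 0 ε ⊆ U ∧ ∀ z ∈ Metric.ball (0 : Phase n) ε, g z = f z := by
  obtain ⟨ε, hε, hεU⟩ := Metric.isOpen_iff.mp hU 0 h0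
  let b : ContDiffBump (0 : Phase n) := ⟨ε / 4, ε / 2, by positivity, by linarith⟩
  refine ⟨fun z => b z * f z, ?_, ε / 4, by positivity,
    (Metric.ball_subset_ball (by linarith)).trans hεU, fun z hz => ?_⟩
  · rw [contDiff_iff_contDiffAt]
    intro z
    by_cases hz : z ∈ Metric.ball (0 : Phase n) ε
    · exact b.contDiffAt.mul (hf.contDiffAt (hU.mem_nhds (hεU hz)))
    · have hz' : z ∈ (Metric.closedBall (0 : Phase n) (ε / 2))ᶜ := by
        intro hmem
        exact hz (Metric.closedBall_subset_ball (by linarith) hmem)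
      have hev : (fun z => b z * f z) =ᶠ[𝓝 z] fun _ => 0 := by
        filter_upwards [Metric.isClosed_closedBall.isOpen_compl.mem_nhds hz'] with w hw
        have hle : b.rOut ≤ dist w 0 := by
          rw [Set.mem_compl_iff, Metric.mem_closedBall, not_le] at hw
          exact hw.le
        rw [b.zero_of_le_dist hle, zero_mul]
      exact contDiffAt_const.congr_of_eventuallyEq hev
  · have : b z = 1 := b.one_of_mem_closedBall (Metric.ball_subset_closedBall hz)
    simp [this]

/-- The diagonal of a multilinear form is given by a polynomial. -/
theorem exists_polyFun_eq_multilinear {k : ℕ}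
    (A : ContinuousMultilinearMap ℝ (fun _ : Fin k => Phase n) ℝ) :
    ∃ p : MvPolynomial (Fin n ⊕ Fin n) ℝ, ∀ z, polyFun p z = A fun _ => z := by
  classical
  refine ⟨∑ r : Fin k → Fin n ⊕ Fin n, C (A fun i => EuclideanSpace.single (r i) (1 : ℝ)) *
    ∏ i, X (r i), fun z => ?_⟩
  have hz : z = ∑ i, z i • EuclideanSpace.single i (1 : ℝ) := by
    ext i
    rw [WithLp.ofLp_sum, Finset.sum_apply, Finset.sum_eq_single i]
    · simp
    · intro b _ hb
      simp [hb.symm]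
    · simp
  have hA : (A fun _ => z) = A fun _ => ∑ i, z i • EuclideanSpace.single i (1 : ℝ) := by
    rw [← hz]
  rw [hA, A.map_sum, polyFun_sum]
  refine Finset.sum_congr rfl fun r _ => ?_
  rw [A.map_smul_univ (fun i => z (r i)) fun i => EuclideanSpace.single (r i) (1 : ℝ), smul_eq_mul,
    mul_comm]
  simp [polyFun]

theorem iteratedDeriv_comp_smul {f : Phase n → ℝ}
    (hf : ContDiff ℝ ((⊤ : ℕ∞) : WithTop ℕ∞) f) (z : Phase n) (k : ℕ) (t : ℝ) :
    iteratedDeriv k (fun t : ℝ => f (t • z)) t = iteratedFDeriv ℝ k f (t • z) fun _ => z := by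
  have h : (fun t : ℝ => f (t • z)) = f ∘ ContinuousLinearMap.toSpanSingleton ℝ z := by
    ext t; simp
  rw [iteratedDeriv_eq_iteratedFDeriv, h,
    ContinuousLinearMap.iteratedFDeriv_comp_right _ hf t (by exact_mod_cast le_top)]
  simp

/-- Taylor's theorem at the origin of phase space. -/
theorem exists_taylor_polynomial {f : Phase n → ℝ}
    (hf : ContDiff ℝ ((⊤ : ℕ∞) : WithTop ℕ∞) f) (m : ℕ) :
    ∃ p : MvPolynomial (Fin n ⊕ Fin n) ℝ,
      (fun z => f z - polyFun p z) =O[𝓝 0] fun z => ‖z‖ ^ (m + 1) := by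
  choose p hp using fun k => exists_polyFun_eq_multilinear (iteratedFDeriv ℝ k f 0)
  refine ⟨∑ k ∈ Finset.range (m + 1), C ((k.factorial : ℝ)⁻¹) * p k, ?_⟩
  have hcont : Continuous fun y => ‖iteratedFDeriv ℝ (m + 1) f y‖ :=
    (hf.continuous_iteratedFDeriv (by exact_mod_cast le_top)).norm
  -- The constant `K` bounds the derivative of order `m + 1` on the compact unit ball; the
  -- one-variable Lagrange remainder of `t ↦ f (t z)` on `[0, 1]` evaluates that derivative inside
  -- the ball.
  obtain ⟨K, hK⟩ := (isCompact_closedBall (0 : Phase n) 1).bddAbove_image hcont.continuousOn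
  refine Asymptotics.IsBigO.of_bound K ?_
  filter_upwards [Metric.closedBall_mem_nhds (0 : Phase n) one_pos] with z hz
  have hg : ContDiff ℝ ((⊤ : ℕ∞) : WithTop ℕ∞) fun t : ℝ => f (t • z) := by fun_prop
  obtain ⟨t, ht, heq⟩ := taylor_mean_remainder_lagrange_iteratedDeriv (n := m) zero_ne_one
    (hg.of_le (by exact_mod_cast le_top)).contDiffOn
  have htay : taylorWithinEval (fun t : ℝ => f (t • z)) m (Set.uIcc 0 1) 0 1 =
      polyFun (∑ k ∈ Finset.range (m + 1), C ((k.factorial : ℝ)⁻¹) * p k) z := by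
    rw [taylor_within_apply, polyFun_sum]
    refine Finset.sum_congr rfl fun k _ => ?_
    rw [iteratedDerivWithin_eq_iteratedDeriv (uniqueDiffOn_uIcc zero_ne_one)
      (hg.of_le (by exact_mod_cast le_top)).contDiffAt (by simp), iteratedDeriv_comp_smul hf,
      zero_smul, polyFun_mul, hp]
    simp
  rw [htay, one_smul, iteratedDeriv_comp_smul hf] at heq
  rw [heq, sub_zero, one_pow, mul_one, norm_div, norm_pow, norm_norm]
  rw [Set.uIoo_of_le zero_le_one] at ht
  have hmem : t • z ∈ Metric.closedBall (0 : Phase n) 1 := by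
    rw [mem_closedBall_zero_iff] at hz ⊢
    rw [norm_smul, Real.norm_of_nonneg ht.1.le]
    nlinarith [norm_nonneg z, ht.1, ht.2]
  have hb : ‖iteratedFDeriv ℝ (m + 1) f (t • z)‖ ≤ K := hK (Set.mem_image_of_mem _ hmem)
  have h1 : ‖iteratedFDeriv ℝ (m + 1) f (t • z) fun _ => z‖ ≤ K * ‖z‖ ^ (m + 1) := by
    refine (ContinuousMultilinearMap.le_opNorm _ _).trans ?_
    rw [Finset.prod_const, Finset.card_univ, Fintype.card_fin]
    gcongr
  refine (div_le_self (norm_nonneg _) ?_).trans h1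
  rw [Real.norm_of_nonneg (Nat.cast_nonneg _)]
  exact_mod_cast Nat.one_le_iff_ne_zero.mpr (Nat.factorial_ne_zero _)

end Taylor

/-! ### Restriction to open sets and closeness to the identity. -/

namespace IsPolyCanonical

variable {n : ℕ} {τ : Phase n ≃ Phase n}
  {T : MvPolynomial (Fin n ⊕ Fin n) ℝ →ₐ[ℝ] MvPolynomial (Fin n ⊕ Fin n) ℝ}

/-- A polynomial canonical transformation as a homeomorphism. -/
def toHomeomorph (h : IsPolyCanonical τ T) : Phase n ≃ₜ Phase n where
  toEquiv := τ
  continuous_toFun := continuousOn_univ.mp h.analytic.continuousOn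
  continuous_invFun := continuousOn_univ.mp h.analytic_symm.continuousOn

/-- The restriction of a polynomial canonical transformation to an open set. -/
def restr (h : IsPolyCanonical τ T) {U : Set (Phase n)} (hU : IsOpen U) :
    OpenPartialHomeomorph (Phase n) (Phase n) :=
  h.toHomeomorph.toOpenPartialHomeomorph.restrOpen U hU

theorem restr_source (h : IsPolyCanonical τ T) {U : Set (Phase n)} (hU : IsOpen U) :
    (h.restr hU).source = U := by
  simp [restr]

theorem restr_coe (h : IsPolyCanonical τ T) {U : Set (Phase n)} (hU : IsOpen U) :
    ⇑(h.restr hU) = τ := rfl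

theorem isAnalyticCanonical_restr (h : IsPolyCanonical τ T) {U : Set (Phase n)} (hU : IsOpen U) :
    IsAnalyticCanonical (h.restr hU) where
  analytic := h.analytic.mono (Set.subset_univ _)
  analytic_symm := h.analytic_symm.mono (Set.subset_univ _)
  bracket F G hF hG z hz := by
    have hmem := (h.restr hU).open_target.mem_nhds ((h.restr hU).map_source hz)
    exact h.bracket F G z ((hF.contDiffAt hmem).differentiableAt (by simp))
      ((hG.contDiffAt hmem).differentiableAt (by simp))

theorem sub_self_isBigO (h : IsPolyCanonical τ T) {k : ℕ}
    (hT : ∀ i, T (X i) - X i ∈ idealOfVars (Fin n ⊕ Fin n) ℝ ^ k) :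
    (fun z => τ z - z) =O[𝓝 0] fun z => ‖z‖ ^ k := by
  classical
  have hsum : (fun z => τ z - z) = fun z =>
      ∑ i, polyFun (T (X i) - X i) z • EuclideanSpace.single i (1 : ℝ) := by
    ext z i
    rw [WithLp.ofLp_sum, Finset.sum_apply, Finset.sum_eq_single i]
    · simp [h.polyFun_comp]
    · intro b _ hb
      simp [hb.symm]
    · simp
  rw [hsum]
  refine Asymptotics.IsBigO.fun_sum fun i _ => ?_
  have h1 := (polyFun_isBigO (hT i)).smul
    (Asymptotics.isBigO_refl (fun _ : Phase n => EuclideanSpace.single i (1 : ℝ)) (𝓝 0))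
  refine h1.trans (Asymptotics.isBigO_of_le _ fun z => ?_)
  rw [norm_smul, PiLp.norm_single, norm_one, mul_one]

end IsPolyCanonical

theorem polyFun_aeval_actionPoly {n : ℕ} (W : MvPolynomial (Fin n) ℝ) (z : Phase n) :
    polyFun (aeval actionPoly W) z = eval (fun j => action j z) W := by
  induction W using MvPolynomial.induction_on with
  | C a => simp [algebraMap_eq]
  | add p q hp hq => rw [map_add, polyFun_add, hp, hq, map_add]
  | mul_X p i hp => rw [map_mul, polyFun_mul, hp, map_mul, aeval_X, eval_X, polyFun_actionPoly]

end Birkhoff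

end

/-! ### Assembly of the theorem. -/

theorem mainTheorem6 (n : ℕ) (ω : Fin n → ℝ)
    (M : Set (Birkhoff.Phase n)) (hM : IsOpen M) (h0 : (0 : Birkhoff.Phase n) ∈ M)
    (P : Birkhoff.Phase n → ℝ) (hP : ContDiffOn ℝ ((⊤ : ℕ∞) : WithTop ℕ∞) P M)
    (hP3 : P =O[𝓝 0] fun z => ‖z‖ ^ 3)
    (r : ℕ) (hr : 3 ≤ r) :
    ∃ (τ : OpenPartialHomeomorph (Birkhoff.Phase n) (Birkhoff.Phase n))
      (Z : MvPolynomial (Fin n ⊕ Fin n) ℝ) (R : Birkhoff.Phase n → ℝ),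
      Birkhoff.IsAnalyticCanonical τ ∧
      (0 : Birkhoff.Phase n) ∈ τ.source ∧ (0 : Birkhoff.Phase n) ∈ τ.target ∧
      τ.source ⊆ M ∧ τ.target ⊆ M ∧
      (∀ z ∈ τ.source,
        Birkhoff.harmonicOscillator ω (τ z) + P (τ z) =
          Birkhoff.harmonicOscillator ω z + Birkhoff.polyFun Z z + R z) ∧
      Z.totalDegree ≤ r ∧
      (∀ z, Birkhoff.poissonBracket (Birkhoff.polyFun Z) (Birkhoff.harmonicOscillator ω) z = 0) ∧
      ContDiffOn ℝ ((⊤ : ℕ∞) : WithTop ℕ∞) R M ∧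
      (R =O[𝓝 0] fun z => ‖z‖ ^ (r + 1)) ∧
      ((fun z => τ z - z) =O[𝓝 0] fun z => ‖z‖ ^ 2) ∧
      (Birkhoff.NonResonantUpTo ω r →
        ∃ W : MvPolynomial (Fin n) ℝ, ∀ z,
          Birkhoff.polyFun Z z = MvPolynomial.eval (fun j => Birkhoff.action j z) W) := by
  open Birkhoff in
  obtain ⟨k, rfl⟩ : ∃ k, r = k + 2 := ⟨r - 2, by omega⟩
  obtain ⟨g, hg, δ, hδ, -, hgP⟩ := exists_contDiff_eq_on_ball hM h0 hP
  obtain ⟨f, hf⟩ := exists_taylor_polynomial hg (k + 2)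
  have hPf : (fun z => P z - polyFun f z) =O[𝓝 0] fun z => ‖z‖ ^ (k + 3) := by
    refine hf.congr' ?_ Filter.EventuallyEq.rfl
    filter_upwards [Metric.ball_mem_nhds 0 hδ] with z hz
    rw [hgP z hz]
  -- Both `P` and `P - f` are `O(‖z‖ ^ 3)`, hence so is `f`.
  have hf3 := mem_pow_idealOfVars_of_isBigO (p := f) (k := 3)
    ((hP3.sub (hPf.trans (isBigO_norm_pow_of_le (by omega)))).congr_left fun z => by ring)
  obtain ⟨τ, T, Z, hτ, hT, hrem, -, hdeg, hLZ, hW⟩ := exists_polynomial_normalForm ω hf3 k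
  have hτO := hτ.sub_self_isBigO hT
  -- The bound holds at the origin itself, where its right-hand side vanishes.
  have hτ0 : τ 0 = 0 := by
    obtain ⟨c, hc⟩ := hτO.bound
    simpa using hc.self_of_nhds
  have hτsmooth : ContDiff ℝ ((⊤ : ℕ∞) : WithTop ℕ∞) τ :=
    contDiff_iff_contDiffAt.mpr fun z => (hτ.analytic z trivial).contDiffAt
  have hUopen : IsOpen (M ∩ τ ⁻¹' M) := hM.inter (hM.preimage hτsmooth.continuous)
  have hU0 : (0 : Phase n) ∈ M ∩ τ ⁻¹' M := ⟨h0, by rw [Set.mem_preimage, hτ0]; exact h0⟩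
  have hsmooth : ContDiffOn ℝ ((⊤ : ℕ∞) : WithTop ℕ∞) (fun z => harmonicOscillator ω (τ z) +
      P (τ z) - harmonicOscillator ω z - polyFun Z z) (M ∩ τ ⁻¹' M) := by
    have hosc : ContDiff ℝ ((⊤ : ℕ∞) : WithTop ℕ∞) (harmonicOscillator ω) := by
      rw [← polyFun_oscPoly]; exact contDiff_polyFun _
    exact (((hosc.comp hτsmooth).contDiffOn.add
      (hP.comp hτsmooth.contDiffOn fun z hz => hz.2)).sub hosc.contDiffOn).sub
      (contDiff_polyFun Z).contDiffOn
  -- `R` has to be smooth on all of `M`, while the formula for the remainder is known to be smooth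
  -- only where `τ z ∈ M`. It is therefore cut off, and the source is shrunk to a ball on which
  -- nothing has changed.
  obtain ⟨R, hR, ε, hε, hεU, hReq⟩ := exists_contDiff_eq_on_ball hUopen hU0 hsmooth
  have hball : IsOpen (Metric.ball (0 : Phase n) ε) := Metric.isOpen_ball
  have hsrc : (hτ.restr hball).source = Metric.ball 0 ε := hτ.restr_source hball
  have h0src : (0 : Phase n) ∈ (hτ.restr hball).source := by
    rw [hsrc]; exact Metric.mem_ball_self hε
  refine ⟨hτ.restr hball, Z, R, hτ.isAnalyticCanonical_restr hball, h0src, ?_, ?_, ?_, ?_, hdeg,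
    ?_, hR.contDiffOn, ?_, hτO, ?_⟩
  · have := (hτ.restr hball).map_source h0src
    rwa [hτ.restr_coe, hτ0] at this
  · rw [hsrc]
    exact fun z hz => (hεU hz).1
  · intro w hw
    have hmem := (hτ.restr hball).map_target hw
    rw [hsrc] at hmem
    have h1 : τ ((hτ.restr hball).symm w) ∈ M := (hεU hmem).2
    rwa [← hτ.restr_coe hball, (hτ.restr hball).right_inv hw] at h1
  · intro z hz
    rw [hsrc] at hz
    rw [hReq z hz, hτ.restr_coe]
    ring
  · intro z
    rw [poissonBracket_polyFun_harmonicOscillator, hLZ]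
    simp [polyFun]
  · have htend : Filter.Tendsto τ (𝓝 0) (𝓝 0) := by
      have := hτsmooth.continuous.tendsto 0
      rwa [hτ0] at this
    have hτlin : (fun z => τ z) =O[𝓝 0] fun z => ‖z‖ := by
      have h1 := hτO.trans (isBigO_norm_pow_of_le (n := n) (by omega : 1 ≤ 2))
      simp only [pow_one] at h1
      exact (h1.add (Asymptotics.isBigO_refl _ _).norm_right).congr_left fun z => by simp
    -- Near the origin `R` is the polynomial remainder of the normal form of `H₀ + f` plus the
    -- Taylor error `(P - f) ∘ τ`; the latter keeps its order since `τ z = O(‖z‖)`.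
    have h1 := (hPf.comp_tendsto htend).trans (hτlin.norm_left.pow (k + 3))
    refine ((polyFun_isBigO hrem).add h1).congr' ?_ Filter.EventuallyEq.rfl
    filter_upwards [Metric.ball_mem_nhds 0 hε] with z hz
    rw [hReq z hz]
    simp only [polyFun_sub, hτ.polyFun_comp, polyFun_add, polyFun_oscPoly, Function.comp_apply]
    ring
  · intro hω
    obtain ⟨W, rfl⟩ := hW hω
    exact ⟨W, polyFun_aeval_actionPoly W⟩
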